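/- Let $k\ge 1$, let $I_1,\dots,I_k$ be (nonempty, bounded) closed intervals of the real line, and let $f:\mathbb{R}\to\mathbb{R}$ be continuous. Call $(I_1,\dots,I_k;f)$ a covering system if $f(I_1\cup\dots\cup I_k)\supseteq I_1\cup\dots\cup I_k$. Then for every covering system $(I_1,\dots,I_k;f)$ there exist a point $x_0\in I_1\cup\dots\cup I_k$ and an integer $l$ with $1\le l\le k$ such that $f^l(x_0)=x_0$, where $f^l$ denotes the $l$-th iterate of $f$. Moreover $g(k)=k$ for every $k\ge1$, where $g(k)$ is the least integer $m$ such that every covering system of $k$ intervals has a point $x$ in the union of its intervals with $f^l(x)=x$ for some $1\le l\le m$. -/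

import Mathlib

/-- The union `I_1 ∪ … ∪ I_k` of the closed intervals `I_j = [a j, b j]`. -/
def intervalUnion {k : ℕ} (a b : Fin k → ℝ) : Set ℝ :=
  ⋃ j, Set.Icc (a j) (b j)

/-- `(I_1, …, I_k; f)` is a covering system, where `I_j = [a j, b j]`: the `I_j` are nonempty
closed bounded intervals (possibly overlapping), `f : ℝ → ℝ` is continuous, and
`f (I_1 ∪ … ∪ I_k) ⊇ I_1 ∪ … ∪ I_k`. -/
structure IsCoveringSystem {k : ℕ} (a b : Fin k → ℝ) (f : ℝ → ℝ) : Prop where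
  le : ∀ j, a j ≤ b j
  continuous : Continuous f
  covers : intervalUnion a b ⊆ f '' intervalUnion a b

/-- Every covering system of `k` intervals has a periodic point of period at most `m`
in the union of its intervals. -/
def IsPeriodBound (k m : ℕ) : Prop :=
  ∀ (a b : Fin k → ℝ) (f : ℝ → ℝ), IsCoveringSystem a b f →
    ∃ x ∈ intervalUnion a b, ∃ l : ℕ, 1 ≤ l ∧ l ≤ m ∧ f^[l] x = x

/-! A backward orbit of `f` in the compact union U nearly returns, so a small perturbation `g`
closes it into a genuine periodic orbit in U; periods at most k survive the limit. Suppose this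
orbit has N + 1 > k points, and let A be the signed matrix recording which gaps between neighbouring
points are stretched over which. By Cayley–Hamilton its characteristic polynomial is 1 + X + ⋯ +
X^N. A gap inside some I_j on a closed walk of length at most k in the graph of A gives, by the
intermediate value theorem, a point of U of period at most k. If there is none, only the gaps inside
no I_j, at most k - 1 of them, can lie on such walks, and the determinant expansion makes the
coefficient of X^(N-k) vanish, a contradiction. For sharpness, k disjoint intervals are permuted
cyclically. -/

/-- A polynomial coefficient vanishes as soon as few indices lie on short cycles of the support
digraph of the matrix. -/
theorem charpoly_coeff_eq_zero_of_few_short_cycles {N n : ℕ} (A : Matrix (Fin N) (Fin N) ℤ)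
    (S : Finset (Fin N)) (hn : n ≤ N) (hS : S.card < n)
    (hA : ∀ s ∉ S, ∀ l, 1 ≤ l → l ≤ n → ∀ u : ℕ → Fin N, u 0 = s → u l = s →
      ∃ i < l, A (u i) (u (i + 1)) = 0) :
    A.charpoly.coeff (N - n) = 0 := by
  classical
  rw [Matrix.charpoly, Matrix.det_apply, Polynomial.finsetSum_coeff]
  refine Finset.sum_eq_zero fun σ _ => ?_
  rw [Polynomial.coeff_smul]
  suffices h : (∏ i, A.charmatrix (σ i) i).coeff (N - n) = 0 by rw [h, smul_zero]
  rw [Fintype.prod_equiv σ (fun i => A.charmatrix (σ i) i) (fun i => A.charmatrix i (σ⁻¹ i))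
    fun i => by simp]
  generalize σ⁻¹ = τ
  have hfix : ∀ i, τ i = i → A.charmatrix i (τ i) = Polynomial.X - Polynomial.C (A i i) := by
    intro i hi
    rw [hi, Matrix.charmatrix_apply_eq]
  have hmov : ∀ i, τ i ≠ i → A.charmatrix i (τ i) = -Polynomial.C (A i (τ i)) :=
    fun i hi => Matrix.charmatrix_apply_ne _ _ _ (Ne.symm hi)
  -- Only fixed indices contribute a factor of degree 1, so moving more than `n` of them leaves
  -- degree below `N - n`.
  by_cases hlt : n < τ.support.card
  · apply Polynomial.coeff_eq_zero_of_natDegree_lt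
    have hdeg : ∀ i ∈ (Finset.univ : Finset (Fin N)),
        (A.charmatrix i (τ i)).natDegree ≤ if i ∈ τ.support then 0 else 1 := by
      intro i _
      split_ifs with h
      · rw [hmov i (Equiv.Perm.mem_support.1 h), Polynomial.natDegree_neg,
          Polynomial.natDegree_C]
      · rw [hfix i (Equiv.Perm.notMem_support.1 h), Polynomial.natDegree_X_sub_C]
    have h1 := (Polynomial.natDegree_prod_le Finset.univ
      (fun i => A.charmatrix i (τ i))).trans (Finset.sum_le_sum hdeg)
    have h2 : (∑ i : Fin N, if i ∈ τ.support then 0 else 1) + τ.support.card = N := by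
      have : τ.support.card = ∑ i : Fin N, if i ∈ τ.support then 1 else 0 := by
        simp [-Equiv.Perm.mem_support]
      rw [this, ← Finset.sum_add_distrib]
      have h3 : ∀ i : Fin N, ((if i ∈ τ.support then 0 else 1) +
        (if i ∈ τ.support then 1 else 0) : ℕ) = 1 := by intro i; split_ifs <;> rfl
      rw [Finset.sum_congr rfl fun i _ => h3 i]
      simp
    omega
  -- Each index outside `S` is then fixed with zero diagonal entry (a loop of length 1) and
  -- contributes a factor X: more than `N - n` of them.
  by_cases hsub : τ.support ⊆ S
  · have hd : (Polynomial.X : Polynomial ℤ) ^ (N - S.card) ∣ ∏ i, A.charmatrix i (τ i) := by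
      have h1 : ∏ i ∈ Sᶜ, A.charmatrix i (τ i) = Polynomial.X ^ (N - S.card) := by
        rw [Finset.prod_eq_pow_card (b := (Polynomial.X : Polynomial ℤ)), Finset.card_compl,
          Fintype.card_fin]
        intro i hi
        have hiS : i ∉ S := Finset.mem_compl.1 hi
        rw [hfix i (Equiv.Perm.notMem_support.1 fun h => hiS (hsub h))]
        obtain ⟨j, hj, h0⟩ := hA i hiS 1 le_rfl (by omega) (fun _ => i) rfl rfl
        rw [h0, Polynomial.C_0, sub_zero]
      rw [← h1, ← Finset.prod_mul_prod_compl S]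
      exact Dvd.intro_left _ rfl
    exact (Polynomial.X_pow_dvd_iff.1 hd) _ (by omega)
  · obtain ⟨s, hs, hsS⟩ := Finset.not_subset.1 hsub
    have hcard : (τ.cycleOf s).support.card ≤ n :=
      (Finset.card_le_card (Equiv.Perm.support_cycleOf_le τ s)).trans (not_lt.1 hlt)
    have hcyc := Equiv.Perm.isCycle_cycleOf τ (Equiv.Perm.mem_support.1 hs)
    obtain ⟨i, -, h0⟩ := hA s hsS (τ.cycleOf s).support.card
      (by have := hcyc.two_le_card_support; omega) hcard (fun i => (τ ^ i) s) rfl (by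
        rw [← hcyc.orderOf]
        have := Equiv.Perm.cycleOf_pow_apply_self τ s (orderOf (τ.cycleOf s))
        rw [← this, pow_orderOf_eq_one]; rfl)
    have hz : A.charmatrix ((τ ^ i) s) (τ ((τ ^ i) s)) = 0 := by
      rw [hmov, ← Equiv.Perm.mul_apply, ← pow_succ', h0, Polynomial.C_0, neg_zero]
      intro h
      have h2 : (τ ^ i) (τ s) = (τ ^ i) s := by
        rw [← Equiv.Perm.mul_apply, ← pow_succ, pow_succ', Equiv.Perm.mul_apply, h]
      exact Equiv.Perm.mem_support.1 hs ((τ ^ i).injective h2)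
    rw [Finset.prod_eq_zero (f := fun i => A.charmatrix i (τ i)) (Finset.mem_univ ((τ ^ i) s)) hz, Polynomial.coeff_zero]

/-! ### Transition matrix of a cyclic permutation -/

/-- The signed transition matrix of a self-map of `Fin (N + 1)`, acting on the `N` intervals
between consecutive points. -/
def transitionMatrix {N : ℕ} (π : Fin (N + 1) → Fin (N + 1)) : Matrix (Fin N) (Fin N) ℤ :=
  Matrix.of fun s t => (if t.castSucc < π s.succ then 1 else 0) -
    (if t.castSucc < π s.castSucc then 1 else 0)

theorem sum_ite_castSucc_lt_mul_sub {N : ℕ} (h : Fin (N + 1) → ℤ) (v : Fin (N + 1)) :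
    ∑ t : Fin N, (if t.castSucc < v then 1 else 0) * (h t.succ - h t.castSucc) = h v - h 0 := by
  induction v using Fin.induction with
  | zero => simp
  | succ i ih =>
    have key : ∀ t : Fin N, (if t.castSucc < i.succ then (1 : ℤ) else 0) *
        (h t.succ - h t.castSucc) = (if t.castSucc < i.castSucc then 1 else 0) *
        (h t.succ - h t.castSucc) + if t = i then h t.succ - h t.castSucc else 0 := by
      intro t
      rcases lt_trichotomy t i with h1 | h1 | h1
      · have h2 : t.castSucc < i.castSucc := h1
        have h3 : t.castSucc < i.succ := h2.trans Fin.castSucc_lt_succ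
        simp [h2, h3, h1.ne]
      · subst h1; simp
      · have h2 : ¬ t.castSucc < i.castSucc := fun h => absurd h1 (not_lt.2 (le_of_lt h))
        have h3 : ¬ t.castSucc < i.succ := by
          rw [Fin.lt_def] at h1 ⊢; simp; omega
        simp [h2, h3, h1.ne']
    rw [Finset.sum_congr rfl fun t _ => key t, Finset.sum_add_distrib, ih]
    simp

/-- The signs make the row sums telescope, so the matrix acts on difference vectors as `h ↦ h ∘ π`.
-/
theorem transitionMatrix_mulVec {N : ℕ} (π : Fin (N + 1) → Fin (N + 1)) (h : Fin (N + 1) → ℤ) :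
    (transitionMatrix π).mulVec (fun t => h t.succ - h t.castSucc) =
      fun t => h (π t.succ) - h (π t.castSucc) := by
  funext s
  simp only [Matrix.mulVec, dotProduct, transitionMatrix, Matrix.of_apply, sub_mul _ _ (_ - _),
    Finset.sum_sub_distrib, sum_ite_castSucc_lt_mul_sub]
  ring

theorem transitionMatrix_pow_mulVec {N : ℕ} (π : Fin (N + 1) → Fin (N + 1)) (m : ℕ)
    (h : Fin (N + 1) → ℤ) :
    ((transitionMatrix π) ^ m).mulVec (fun t => h t.succ - h t.castSucc) =
      fun t => h (π^[m] t.succ) - h (π^[m] t.castSucc) := by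
  induction m generalizing h with
  | zero => simp
  | succ m ih =>
    rw [pow_succ, ← Matrix.mulVec_mulVec, transitionMatrix_mulVec, ih (fun v => h (π v))]
    funext t
    simp only [Function.iterate_succ_apply']

/-- If `π` is a single cycle, then `1 + X + ⋯ + X ^ N` is the characteristic polynomial of its
transition matrix. -/
theorem charpoly_transitionMatrix_coeff {N : ℕ} (π : Fin (N + 1) → Fin (N + 1)) (v : Fin (N + 1))
    (hv : Function.minimalPeriod π v = N + 1) {m : ℕ} (hm : m ≤ N) :
    (transitionMatrix π).charpoly.coeff m = 1 := by
  classical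
  set A := transitionMatrix π
  set c := A.charpoly.coeff
  have hdeg : A.charpoly.natDegree = N := by
    rw [Matrix.charpoly_natDegree_eq_dim, Fintype.card_fin]
  have hlead : c N = 1 := by
    have := A.charpoly_monic.coeff_natDegree
    rwa [hdeg] at this
  set h : Fin (N + 1) → ℤ := fun w => if w = v then 1 else 0
  -- Cayley–Hamilton says that `F` has zero differences, hence is constant; along the cycle its
  -- values are the coefficients.
  set F : Fin (N + 1) → ℤ := fun w => ∑ i ∈ Finset.range (N + 1), c i * h (π^[i] w)
  have hstep : ∀ t : Fin N, F t.succ = F t.castSucc := by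
    intro t
    have h0 := congrArg (fun M => M.mulVec (fun t : Fin N => h t.succ - h t.castSucc) t)
      (Matrix.aeval_self_charpoly A)
    simp only [Polynomial.aeval_eq_sum_range, hdeg, Matrix.sum_mulVec, Matrix.smul_mulVec,
      Finset.sum_apply, Pi.smul_apply, transitionMatrix_pow_mulVec, A, Matrix.zero_mulVec,
      Pi.zero_apply, smul_eq_mul, mul_sub, Finset.sum_sub_distrib] at h0
    exact sub_eq_zero.1 h0
  have hconst : ∀ w, F w = F 0 := by
    intro w
    induction w using Fin.induction with
    | zero => rfl
    | succ i ih => rw [hstep, ih]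
  have hval : ∀ i ≤ N, F (π^[N + 1 - i] v) = c i := by
    intro i hi
    simp only [F]
    rw [Finset.sum_eq_single i]
    · rw [← Function.iterate_add_apply, show i + (N + 1 - i) = N + 1 by omega]
      have : π^[N + 1] v = v := by
        have := Function.iterate_minimalPeriod (f := π) (x := v)
        rwa [hv] at this
      simp [h, this]
    · intro j hj hji
      have hne : π^[j] (π^[N + 1 - i] v) ≠ v := by
        rw [← Function.iterate_add_apply]
        intro heq
        have hd : Function.minimalPeriod π v ∣ j + (N + 1 - i) :=
          Function.IsPeriodicPt.minimalPeriod_dvd heq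
        rw [hv] at hd
        obtain ⟨q, hq⟩ := hd
        have hjN := Finset.mem_range.1 hj
        have hq1 : q = 1 := by
          rcases q with _ | _ | q
          · omega
          · rfl
          · exfalso
            have : (N + 1) * (q + 1 + 1) = (N + 1) * q + 2 * (N + 1) := by ring
            omega
        subst hq1
        omega
      simp [h, hne]
    · intro hi'
      exact absurd (Finset.mem_range.2 (by omega)) hi'
  rw [← hlead]
  show c m = c N
  rw [← hval m hm, ← hval N le_rfl, hconst, hconst (π^[N + 1 - N] v)]

/-! ### Short periods from a periodic orbit -/

theorem isCompact_intervalUnion {k : ℕ} (a b : Fin k → ℝ) : IsCompact (intervalUnion a b) :=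
  isCompact_iUnion fun _ => isCompact_Icc

/-- Itinerary lemma: a loop of intervals covering one another carries a periodic point. -/
theorem exists_iterate_eq_of_loop {g : ℝ → ℝ} (hg : Continuous g) {c d : ℕ → ℝ} {l : ℕ}
    (hcov : ∀ i < l, Set.Icc (c (i + 1)) (d (i + 1)) ⊆ g '' Set.Icc (c i) (d i))
    (hc : c l = c 0) (hd : d l = d 0) (hle : c 0 ≤ d 0) :
    ∃ x ∈ Set.Icc (c 0) (d 0), g^[l] x = x := by
  have h : ∀ i ≤ l, Set.Icc (c i) (d i) ⊆ g^[i] '' Set.Icc (c 0) (d 0) := by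
    intro i
    induction i with
    | zero => simp
    | succ i ih =>
      intro hi
      refine (hcov i hi).trans ?_
      rw [Function.iterate_succ', Set.image_comp]
      exact Set.image_mono (ih (Nat.le_of_succ_le hi))
  have hl := h l le_rfl
  rw [hc, hd] at hl
  exact exists_mem_Icc_isFixedPt_of_surjOn (hg.iterate l).continuousOn hle hl

/-- If a union of `k` intervals contains a whole periodic orbit, then it contains a periodic point
of period at most `k`. -/
theorem exists_short_period_of_periodic_orbit {k : ℕ} (a b : Fin k → ℝ) {g : ℝ → ℝ}
    (hg : Continuous g) {x : ℝ} (hx : x ∈ Function.periodicPts g)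
    (hU : ∀ m, g^[m] x ∈ intervalUnion a b) :
    ∃ y ∈ intervalUnion a b, ∃ l, 1 ≤ l ∧ l ≤ k ∧ g^[l] y = y := by
  classical
  have hpos := Function.minimalPeriod_pos_of_mem_periodicPts hx
  obtain ⟨N, hN⟩ : ∃ N, Function.minimalPeriod g x = N + 1 := ⟨_, (Nat.succ_pred hpos.ne').symm⟩
  by_cases hNk : N + 1 ≤ k
  · exact ⟨x, hU 0, N + 1, by omega, hNk, hN ▸ Function.iterate_minimalPeriod⟩
  by_contra hno
  have hk0 : 0 < k := by
    obtain ⟨j, -⟩ := Set.mem_iUnion.1 (hU 0)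
    exact j.pos
  set P : Finset ℝ := (Finset.range (N + 1)).image fun m => g^[m] x
  have hPcard : P.card = N + 1 := by
    rw [Finset.card_image_of_injOn, Finset.card_range]
    have := Function.iterate_injOn_Iio_minimalPeriod (f := g) (x := x)
    rw [hN] at this
    simpa using this
  have hPmem : ∀ m, g^[m] x ∈ P := by
    intro m
    rw [← Function.iterate_mod_minimalPeriod_eq, hN]
    exact Finset.mem_image_of_mem _ (Finset.mem_range.2 (Nat.mod_lt _ (Nat.succ_pos _)))
  set e := P.orderEmbOfFin hPcard
  have hrange : ∀ y ∈ P, ∃ v, e v = y := by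
    intro y hy
    have : y ∈ Set.range e := by rw [Finset.range_orderEmbOfFin]; exact hy
    exact this
  have heP : ∀ v, e v ∈ P := fun v => Finset.orderEmbOfFin_mem _ _ _
  have hgP : ∀ v, g (e v) ∈ P := by
    intro v
    obtain ⟨m, -, hm⟩ := Finset.mem_image.1 (heP v)
    rw [← hm, ← Function.iterate_succ_apply' g m x]
    exact hPmem _
  choose π hπ using fun v => hrange _ (hgP v)
  have hπm : ∀ m v, e (π^[m] v) = g^[m] (e v) := by
    intro m v
    exact (Function.Semiconj.iterate_right (f := e) (ga := π) (gb := g) (fun v => hπ v) m) v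
  obtain ⟨v₀, hv₀⟩ := hrange x (hPmem 0)
  have hper : Function.minimalPeriod π v₀ = N + 1 := by
    refine Eq.trans ?_ hN
    rw [Function.minimalPeriod_eq_minimalPeriod_iff]
    intro n
    simp only [Function.IsPeriodicPt, Function.IsFixedPt]
    rw [← hv₀, ← hπm, e.injective.eq_iff]
  have heU : ∀ v, e v ∈ intervalUnion a b := by
    intro v
    obtain ⟨m, -, hm⟩ := Finset.mem_image.1 (heP v)
    rw [← hm]; exact hU m
  choose j hj using fun v => Set.mem_iUnion.1 (heU v)
  -- the consecutive pairs lying in no common interval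
  set S : Finset (Fin N) := Finset.univ.filter fun s =>
    ∀ i, ¬ (e s.castSucc ∈ Set.Icc (a i) (b i) ∧ e s.succ ∈ Set.Icc (a i) (b i))
  have hSk : S.card < k := by
    -- The leftmost point and the right ends of the gaps in `S` lie in pairwise different intervals,
    -- so `S.card + 1 ≤ k`.
    set T : Finset (Fin (N + 1)) := insert 0 (S.map (Fin.succEmb N))
    have hT : T.card = S.card + 1 := by
      rw [Finset.card_insert_of_notMem, Finset.card_map]
      simp [Fin.succ_ne_zero]
    have hne : ∀ u ∈ T, ∀ v ∈ T, u < v → j u ≠ j v := by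
      intro u _ v hv huv heq
      rcases Finset.mem_insert.1 hv with rfl | hv
      · exact absurd huv (Fin.not_lt_zero _)
      · obtain ⟨s, hs, rfl⟩ := Finset.mem_map.1 hv
        have hus : u ≤ s.castSucc := by
          rw [Fin.le_def]; rw [Fin.lt_def] at huv; simp at huv ⊢; omega
        have h1 : e u ≤ e s.castSucc := e.monotone hus
        have h2 : e s.castSucc ≤ e s.succ := e.monotone Fin.castSucc_lt_succ.le
        have h3 := hj (Fin.succEmb N s)
        have h4 := hj u
        rw [heq] at h4
        exact (Finset.mem_filter.1 hs).2 _ ⟨⟨h4.1.trans h1, h2.trans h3.2⟩, h3⟩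
    have hinj : Set.InjOn j T := by
      intro u hu v hv huv
      rcases lt_trichotomy u v with h | h | h
      · exact absurd huv (hne u hu v hv h)
      · exact h
      · exact absurd huv.symm (hne v hv u hu h)
    have := Finset.card_le_card_of_injOn j (t := Finset.univ) (fun _ _ => Finset.mem_univ _) hinj
    rw [hT, Finset.card_univ, Fintype.card_fin] at this
    omega
  have hcoef := charpoly_coeff_eq_zero_of_few_short_cycles (transitionMatrix π) S (n := k)
    (by omega) hSk ?_
  · rw [charpoly_transitionMatrix_coeff π v₀ hper (Nat.sub_le _ _)] at hcoef
    exact one_ne_zero hcoef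
  intro s hs l hl1 hlk u hu0 hul
  by_contra! hne
  have hcov : ∀ i < l, Set.Icc (e (u (i + 1)).castSucc) (e (u (i + 1)).succ) ⊆
      g '' Set.Icc (e (u i).castSucc) (e (u i).succ) := by
    intro i hi
    have hAi := hne i hi
    set p := u i
    set q := u (i + 1)
    have hle : e p.castSucc ≤ e p.succ := e.monotone Fin.castSucc_lt_succ.le
    simp only [transitionMatrix, Matrix.of_apply] at hAi
    -- A nonzero entry means that the images of the ends of gap `p` lie on opposite sides of gap
    -- `q`; its sign is the orientation.
    by_cases h1 : q.castSucc < π p.succ <;> by_cases h2 : q.castSucc < π p.castSucc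
    · simp [h1, h2] at hAi
    · refine subset_trans (Set.Icc_subset_Icc ?_ ?_) (intermediate_value_Icc hle hg.continuousOn)
      · rw [← hπ]; exact e.monotone (not_lt.1 h2)
      · rw [← hπ]; exact e.monotone (Fin.castSucc_lt_iff_succ_le.1 h1)
    · refine subset_trans (Set.Icc_subset_Icc ?_ ?_) (intermediate_value_Icc' hle hg.continuousOn)
      · rw [← hπ]; exact e.monotone (not_lt.1 h1)
      · rw [← hπ]; exact e.monotone (Fin.castSucc_lt_iff_succ_le.1 h2)
    · simp [h1, h2] at hAi
  obtain ⟨y, hy, hly⟩ := exists_iterate_eq_of_loop hg (c := fun i => e (u i).castSucc)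
    (d := fun i => e (u i).succ) hcov (by simp only [hul, hu0]) (by simp only [hul, hu0])
    (e.monotone Fin.castSucc_lt_succ.le)
  simp only [hu0] at hy
  have hs' : ∃ i, e s.castSucc ∈ Set.Icc (a i) (b i) ∧ e s.succ ∈ Set.Icc (a i) (b i) := by
    by_contra! h
    exact hs (Finset.mem_filter.2 ⟨Finset.mem_univ _, fun i hi => h i hi.1 hi.2⟩)
  obtain ⟨i, h1, h2⟩ := hs'
  exact hno ⟨y, Set.mem_iUnion.2 ⟨i, h1.1.trans hy.1, hy.2.trans h2.2⟩, l, hl1, hlk, hly⟩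

/-! ### Perturbation and limit -/

/-- A continuous map whose image of a compact set covers it can be perturbed to have a periodic
orbit inside that set. -/
theorem exists_perturbation_with_periodic_orbit {K : Set ℝ} (hK : IsCompact K)
    (hne : K.Nonempty) {f : ℝ → ℝ} (hf : Continuous f) (hcov : K ⊆ f '' K) {δ : ℝ} (hδ : 0 < δ) :
    ∃ g : ℝ → ℝ, Continuous g ∧ (∀ x, dist (f x) (g x) < δ) ∧
      ∃ x ∈ Function.periodicPts g, ∀ m, g^[m] x ∈ K := by
  classical
  obtain ⟨y₀, hy₀⟩ := hne
  choose! r hrK hr using fun y (hy : y ∈ K) => (hcov hy : ∃ z, z ∈ K ∧ f z = y)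
  set y : ℕ → ℝ := fun n => r^[n] y₀
  have hyK : ∀ n, y n ∈ K := by
    intro n
    induction n with
    | zero => exact hy₀
    | succ n ih => simp only [y, Function.iterate_succ_apply']; exact hrK _ ih
  have hfy : ∀ n, f (y (n + 1)) = y n := by
    intro n
    simp only [y, Function.iterate_succ_apply']
    exact hr _ (hyK n)
  have hex : ∃ d, 0 < d ∧ ∃ i, dist (y i) (y (i + d)) < δ := by
    obtain ⟨z, -, φ, hφ, hlim⟩ := hK.tendsto_subseq hyK
    obtain ⟨n, hn⟩ := Metric.cauchySeq_iff.1 hlim.cauchySeq δ hδ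
    have hlt : φ n < φ (n + 1) := hφ n.lt_succ_self
    refine ⟨φ (n + 1) - φ n, by omega, φ n, ?_⟩
    rw [Nat.add_sub_cancel' hlt.le]
    exact hn n le_rfl (n + 1) n.le_succ
  obtain ⟨hd0, i, hi⟩ := Nat.find_spec hex
  -- With `d` least, a repeated point would be a shorter return at distance 0; distinctness lets the
  -- bump `φ` alter `f` at `y (i + 1)` only, among the orbit points.
  have hmin : ∀ d', 0 < d' → d' < Nat.find hex → ∀ i, ¬ dist (y i) (y (i + d')) < δ :=
    fun d' h0 hlt i h => Nat.find_min hex hlt ⟨h0, i, h⟩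
  generalize Nat.find hex = d at hd0 hi hmin
  have hinj : ∀ s t, s < t → t < d → y (i + 1 + s) ≠ y (i + 1 + t) := by
    intro s t hst htd h
    refine hmin (t - s) (by omega) (by omega) (i + 1 + s) ?_
    rw [show i + 1 + s + (t - s) = i + 1 + t by omega, ← h, dist_self]
    exact hδ
  set Q : Set ℝ := (fun s => y (i + 1 + s)) '' Set.Ioo 0 d
  have hQ : IsClosed Q := ((Set.finite_Ioo 0 d).image _).isClosed
  obtain ⟨φ, hφQ, hφ1, hφI⟩ := exists_continuous_zero_one_of_isClosed hQ
    (isClosed_singleton (x := y (i + 1))) (by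
      rw [Set.disjoint_singleton_right]
      rintro ⟨s, ⟨hs0, hsd⟩, hs⟩
      exact hinj 0 s hs0 hsd hs.symm)
  have hφ1' : φ (y (i + 1)) = 1 := hφ1 rfl
  set g : ℝ → ℝ := fun x => f x + (y (i + d) - y i) * φ x
  have hgstep : ∀ s, s + 1 < d → g (y (i + 1 + (s + 1))) = y (i + 1 + s) := by
    intro s hs
    have h0 : φ (y (i + 1 + (s + 1))) = 0 := hφQ ⟨s + 1, ⟨Nat.succ_pos _, hs⟩, rfl⟩
    simp only [g, h0, mul_zero, add_zero]
    exact hfy (i + 1 + s)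
  have hglast : g (y (i + 1)) = y (i + d) := by
    simp only [g, hφ1', hfy]; ring
  have hiter : ∀ t < d, g^[t] (y (i + d)) = y (i + d - t) := by
    intro t
    induction t with
    | zero => simp
    | succ t ih =>
      intro ht
      rw [Function.iterate_succ_apply', ih (by omega)]
      have := hgstep (d - t - 2) (by omega)
      rwa [show i + 1 + (d - t - 2 + 1) = i + d - t by omega,
        show i + 1 + (d - t - 2) = i + d - (t + 1) by omega] at this
  have hper : Function.IsPeriodicPt g d (y (i + d)) := by
    show g^[d] (y (i + d)) = y (i + d)
    obtain ⟨d, rfl⟩ : ∃ d', d = d' + 1 := ⟨d - 1, by omega⟩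
    rw [Function.iterate_succ_apply', hiter d (by omega), show i + (d + 1) - d = i + 1 by omega,
      hglast]
  refine ⟨g, by fun_prop, fun x => ?_, y (i + d), ⟨d, hd0, hper⟩, fun m => ?_⟩
  · have h1 := hφI x
    rw [dist_comm, Real.dist_eq]
    rw [dist_comm, Real.dist_eq] at hi
    simp only [g, add_sub_cancel_left, abs_mul]
    rw [abs_of_nonneg h1.1]
    exact (mul_le_of_le_one_right (abs_nonneg _) h1.2).trans_lt hi
  · rw [← hper.iterate_mod_apply, hiter _ (Nat.mod_lt _ hd0)]
    exact hyK _

/-- Short periodic points inside a compact set survive uniform limits of maps. -/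
theorem exists_short_period_of_tendstoUniformly {K : Set ℝ} (hK : IsCompact K) {k : ℕ}
    {f : ℝ → ℝ} (hf : Continuous f) {g : ℕ → ℝ → ℝ} (hg : TendstoUniformly g f Filter.atTop)
    (h : ∀ n, ∃ x ∈ K, ∃ l, 1 ≤ l ∧ l ≤ k ∧ (g n)^[l] x = x) :
    ∃ x ∈ K, ∃ l, 1 ≤ l ∧ l ≤ k ∧ f^[l] x = x := by
  choose x hxK l hl1 hlk hx using h
  obtain ⟨⟨z, m⟩, hzm, φ, hφ, hlim⟩ := (hK.prod (Set.finite_Icc 1 k).isCompact).tendsto_subseq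
    (x := fun n => (x n, l n)) (fun n => ⟨hxK n, hl1 n, hlk n⟩)
  have hlx : Filter.Tendsto (x ∘ φ) Filter.atTop (nhds z) :=
    (continuous_fst.tendsto _).comp hlim
  have hll : Filter.Tendsto (l ∘ φ) Filter.atTop (nhds m) :=
    (continuous_snd.tendsto _).comp hlim
  have hiter : ∀ t, Filter.Tendsto (fun n => (g (φ n))^[t] (x (φ n))) Filter.atTop
      (nhds (f^[t] z)) := by
    intro t
    induction t with
    | zero => exact hlx
    | succ t ih =>
      simp only [Function.iterate_succ_apply']
      have hgφ : TendstoUniformly (fun n => g (φ n)) f Filter.atTop :=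
        fun u hu => hφ.tendsto_atTop.eventually (hg u hu)
      exact hgφ.tendsto_comp hf.continuousAt ih
  refine ⟨z, hzm.1, m, hzm.2.1, hzm.2.2, tendsto_nhds_unique (hiter m) (hlx.congr' ?_)⟩
  -- The periods converge in a discrete space, so they eventually equal `m`.
  rw [nhds_discrete, Filter.tendsto_pure] at hll
  filter_upwards [hll] with n hn
  have := hx (φ n)
  simp only [Function.comp_apply] at hn ⊢
  rw [hn] at this
  exact this.symm

theorem IsCoveringSystem.exists_short_period {k : ℕ} (hk : 1 ≤ k) {a b : Fin k → ℝ} {f : ℝ → ℝ}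
    (h : IsCoveringSystem a b f) :
    ∃ x ∈ intervalUnion a b, ∃ l : ℕ, 1 ≤ l ∧ l ≤ k ∧ f^[l] x = x := by
  have hK := isCompact_intervalUnion a b
  have hne : (intervalUnion a b).Nonempty :=
    ⟨a ⟨0, hk⟩, Set.mem_iUnion.2 ⟨⟨0, hk⟩, Set.left_mem_Icc.2 (h.le _)⟩⟩
  choose g hgc hgf x hx hxU using fun n : ℕ => exists_perturbation_with_periodic_orbit hK hne
    h.continuous h.covers (δ := 1 / ((n : ℝ) + 1)) (by positivity)
  refine exists_short_period_of_tendstoUniformly hK h.continuous (g := g) ?_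
    fun n => exists_short_period_of_periodic_orbit a b (hgc n) (hx n) (hxU n)
  rw [Metric.tendstoUniformly_iff]
  intro ε hε
  filter_upwards [(tendsto_one_div_add_atTop_nhds_zero_nat (𝕜 := ℝ)).eventually_lt_const hε]
    with n hn y
  exact (hgf n y).trans hn

/-! ### Sharpness: rotating disjoint intervals -/

/-- A continuous piecewise linear map sending `[2 j, 2 j + 1]` onto the next such interval for
`j < k - 1`, and `[2 k - 2, 2 k - 1]` onto `[0, 1]`. -/
noncomputable def rotatingMap (k : ℕ) (x : ℝ) : ℝ :=
  min (x + 2) (max (2 * k - 1 - x) (2 * k * (2 * k - 2 - x) + 1))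

/-- The line of slope -2k through (2k - 2, 1) is above x + 2 here; it only joins the two useful
branches across the last gap. -/
theorem rotatingMap_of_le {k : ℕ} {x : ℝ} (hx : x ≤ 2 * k - 3) :
    rotatingMap k x = x + 2 := by
  have hk : (0 : ℝ) ≤ k := k.cast_nonneg
  refine min_eq_left (le_max_of_le_right ?_)
  nlinarith

theorem rotatingMap_of_ge {k : ℕ} {x : ℝ} (hk : 1 ≤ k) (hx : 2 * k - 2 ≤ x) :
    rotatingMap k x = 2 * k - 1 - x := by
  have hk' : (1 : ℝ) ≤ k := by exact_mod_cast hk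
  have h1 : 2 * k * (2 * k - 2 - x) + 1 ≤ 2 * k - 1 - x := by nlinarith
  rw [rotatingMap, max_eq_left h1]
  exact min_eq_right (by linarith)

theorem isCoveringSystem_rotatingMap {k : ℕ} (hk : 1 ≤ k) :
    IsCoveringSystem (fun j : Fin k => 2 * (j : ℝ)) (fun j => 2 * (j : ℝ) + 1) (rotatingMap k) where
  le j := by linarith
  continuous := by unfold rotatingMap; fun_prop
  covers := by
    intro x hx
    obtain ⟨⟨j, hj⟩, h1, h2⟩ := Set.mem_iUnion.1 hx
    simp only at h1 h2
    rcases j with _ | j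
    · simp only [Nat.cast_zero, mul_zero, zero_add] at h1 h2
      refine ⟨2 * k - 1 - x, Set.mem_iUnion.2 ⟨⟨k - 1, by omega⟩, ?_, ?_⟩, ?_⟩
      · simp only [Nat.cast_sub hk, Nat.cast_one]; linarith
      · simp only [Nat.cast_sub hk, Nat.cast_one]; linarith
      · rw [rotatingMap_of_ge hk (by linarith)]; ring
    · have hj' : (j : ℝ) + 2 ≤ k := by exact_mod_cast hj
      push_cast at h1 h2
      have hj0 : (0 : ℝ) ≤ j := j.cast_nonneg
      refine ⟨x - 2, Set.mem_iUnion.2 ⟨⟨j, by omega⟩, ?_, ?_⟩, ?_⟩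
      · simp only; linarith
      · simp only; linarith
      · rw [rotatingMap_of_le (by linarith)]; ring

theorem rotatingMap_iterate_mem {k : ℕ} (hk : 1 ≤ k) {j : ℕ} (hj : j < k) {x : ℝ}
    (hx : x ∈ Set.Icc (2 * (j : ℝ)) (2 * j + 1)) (l : ℕ) :
    (rotatingMap k)^[l] x ∈ Set.Icc (2 * (((j + l) % k : ℕ) : ℝ)) (2 * ((j + l) % k : ℕ) + 1) := by
  induction l with
  | zero => simpa [Nat.mod_eq_of_lt hj] using hx
  | succ l ih =>
    rw [Function.iterate_succ_apply']
    generalize (rotatingMap k)^[l] x = y at ih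
    have hlt : (j + l) % k < k := Nat.mod_lt _ hk
    have hmod : (j + (l + 1)) % k = ((j + l) % k + 1) % k := by
      rw [Nat.mod_add_mod, add_assoc]
    rw [hmod]
    generalize (j + l) % k = i at *
    obtain ⟨h1, h2⟩ := ih
    have hi0 : (0 : ℝ) ≤ i := i.cast_nonneg
    rcases (Nat.succ_le_of_lt hlt).eq_or_lt with h | h
    · have hik : (k : ℝ) = i + 1 := by rw [← h]; push_cast; ring
      rw [rotatingMap_of_ge hk (by linarith), show i + 1 = k from h, Nat.mod_self]
      constructor <;> push_cast <;> linarith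
    · have hik : (i : ℝ) + 2 ≤ k := by exact_mod_cast h
      rw [rotatingMap_of_le (by linarith), Nat.mod_eq_of_lt h]
      constructor <;> push_cast <;> linarith

/-- The intervals are disjoint and their indices advance by 1 modulo `k`, so returning after `l`
steps forces `k ∣ l`. -/
theorem IsPeriodBound.le {k m : ℕ} (hk : 1 ≤ k) (h : IsPeriodBound k m) : k ≤ m := by
  obtain ⟨x, hx, l, hl1, hlm, hl⟩ := h _ _ _ (isCoveringSystem_rotatingMap hk)
  obtain ⟨⟨j, hj⟩, hxj⟩ := Set.mem_iUnion.1 hx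
  have hmem := rotatingMap_iterate_mem hk hj hxj l
  rw [hl] at hmem
  have heq : (j + l) % k = j := by
    generalize (j + l) % k = i at hmem
    have h1 : (2 * i : ℝ) ≤ 2 * j + 1 := hmem.1.trans hxj.2
    have h2 : (2 * j : ℝ) ≤ 2 * i + 1 := hxj.1.trans hmem.2
    have h1' : 2 * i ≤ 2 * j + 1 := by exact_mod_cast h1
    have h2' : 2 * j ≤ 2 * i + 1 := by exact_mod_cast h2
    omega
  have hmod : (j + l) ≡ j + 0 [MOD k] := by
    rw [Nat.ModEq, heq, add_zero, Nat.mod_eq_of_lt hj]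
  have hdvd : k ∣ l := (Nat.modEq_zero_iff_dvd).1 (Nat.ModEq.add_left_cancel' j hmod)
  exact (Nat.le_of_dvd hl1 hdvd).trans hlm

/-- Every covering system of `k ≥ 1` intervals has a point `x₀` in the union of the intervals
with `f^l x₀ = x₀` for some `1 ≤ l ≤ k`; and `g(k) = k`, where `g(k)` is the least `m` such that
every covering system of `k` intervals has a periodic point of period at most `m`. -/
theorem theorem1 (k : ℕ) (hk : 1 ≤ k) :
    (∀ (a b : Fin k → ℝ) (f : ℝ → ℝ), IsCoveringSystem a b f →
      ∃ x₀ ∈ intervalUnion a b, ∃ l : ℕ, 1 ≤ l ∧ l ≤ k ∧ f^[l] x₀ = x₀) ∧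
    IsLeast {m : ℕ | IsPeriodBound k m} k :=
  ⟨fun _ _ _ h => h.exists_short_period hk,
    fun _ _ _ h => h.exists_short_period hk, fun _ h => IsPeriodBound.le hk h⟩
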